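/- Let $\mathcal H$ be a real Hilbert space, let $g\in\mathbb N$, and write $SM_n(\mathbb R)^g$ for the set of $g$-tuples of real symmetric $n\times n$ matrices. Let $A=(A_1,\dots,A_g)$ be a $g$-tuple of compact self-adjoint operators on $\mathcal H$. For $X\in SM_n(\mathbb R)^g$ put $$L_A(X)=I_{\mathcal H}\otimes I_n-\sum_{i=1}^g A_i\otimes X_i$$ on $\mathcal H\otimes\mathbb R^n$, let $\mathcal D_A(n)=\{X\in SM_n(\mathbb R)^g: L_A(X)\succeq 0\}$ and $\mathcal D_A=\bigcup_{n\ge 1}\mathcal D_A(n)$ (a generalized free spectrahedron). Assume that $\mathcal D_A$ is bounded, i.e. there is a real $C$ with $C I_n-\sum_{i=1}^g X_i^2\succeq 0$ for all $n\ge 1$ and all $X\in\mathcal D_A(n)$. For $X\in\mathcal D_A(n)$: * $X$ is an *Arveson extreme point* of $\mathcal D_A$ if for every $\ell\ge 1$, $\beta\in M_{n\times\ell}(\mathbb R)^g$ and $\gamma\in SM_\ell(\mathbb R)^g$ with $\begin{pmatrix}X&\beta\\ \beta^*&\gamma\end{pmatrix}\in\mathcal D_A(n+\ell)$ one has $\beta=0$.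 * The *dilation subspace* $\mathfrak D(X)$ of $\mathcal D_A$ at $X$ is the linear span in $M_{n\times 1}(\mathbb R)^g$ of all $\beta$ for which there is a $\gamma\in\mathbb R^g$ with $\begin{pmatrix}X&\beta\\ \beta^*&\gamma\end{pmatrix}\in\mathcal D_A(n+1)$. * A tuple $\hat Y=\begin{pmatrix}X&\hat\beta\\ \hat\beta^*&\hat\gamma\end{pmatrix}\in\mathcal D_A(n+1)$ with $\hat\beta\in M_{n\times1}(\mathbb R)^g$ nonzero and $\hat\gamma\in\mathbb R^g$ is a *maximal $1$-dilation* of $X$ if (1) $1=\max\left\{\alpha\in\mathbb R:\ \exists\,\gamma\in\mathbb R^g,\ L_A\begin{pmatrix}X&\alpha\hat\beta\\ \alpha\hat\beta^*&\gamma\end{pmatrix}\succeq0\right\}$, and (2) $\hat\gamma$ is an extreme point of the convex set $\left\{\gamma\in\mathbb R^g:\ \begin{pmatrix}X&\hat\beta\\ \hat\beta^*&\gamma\end{pmatrix}\in\mathcal D_A(n+1)\right\}$. **Theorem.** Let $n\ge 1$ and let $X\in\mathcal D_A(n)$ not be an Arveson extreme point of $\mathcal D_A$. Then there exists a maximal $1$-dilation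 $\hat Y\in\mathcal D_A(n+1)$ of $X$. Furthermore, every maximal $1$-dilation $\hat Y\in\mathcal D_A(n+1)$ of $X$ satisfies $$\dim\mathfrak D(\hat Y)<\dim\mathfrak D(X).$$ -/

import Mathlib

open scoped TensorProduct

noncomputable section

namespace FreeSpec

/-- `M_{m × n}(ℝ)^g`: the `g`-tuples of real `m × n` matrices. -/
abbrev MatTuple (g m n : ℕ) : Type := Fin g → Matrix (Fin m) (Fin n) ℝ

/-- A set of `g`-tuples of square matrices of all sizes, given by its levels `K n`. -/
abbrev MatSet (g : ℕ) : Type := (n : ℕ) → Set (MatTuple g n n)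

/-- The tuple of block matrices with entries `X i`, `β i`, `(β i)ᵀ`, `γ i`, of size `n + l`. -/
def block {g n l : ℕ} (X : MatTuple g n n) (β : MatTuple g n l) (γ : MatTuple g l l) :
    MatTuple g (n + l) (n + l) :=
  fun i => Matrix.reindex finSumFinEquiv finSumFinEquiv
    (Matrix.fromBlocks (X i) (β i) (β i).transpose (γ i))

/-- A point of `ℝ^g` as a `g`-tuple of `1 × 1` matrices. -/
def scalarTuple {g : ℕ} (γ : Fin g → ℝ) : MatTuple g 1 1 :=
  fun i => Matrix.of fun _ _ => γ i

section Pencil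

variable {H : Type*} [NormedAddCommGroup H] [InnerProductSpace ℝ H]

/-- `Λ_A(X) = A₁ ⊗ X₁ + ⋯ + A_g ⊗ X_g`, an operator on the Hilbert space `H ⊗ ℝⁿ` (the algebraic
tensor product is already complete, since `ℝⁿ` is finite dimensional). -/
def linPart {g n : ℕ} (A : Fin g → H →L[ℝ] H) (X : MatTuple g n n) :
    (H ⊗[ℝ] EuclideanSpace ℝ (Fin n)) →ₗ[ℝ] (H ⊗[ℝ] EuclideanSpace ℝ (Fin n)) :=
  ∑ i, TensorProduct.map (A i : H →ₗ[ℝ] H) (Matrix.toEuclideanLin (X i))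

/-- The evaluation `L_A(X) = I - Λ_A(X)` of the monic linear pencil at `X`. -/
def pencil {g n : ℕ} (A : Fin g → H →L[ℝ] H) (X : MatTuple g n n) :
    (H ⊗[ℝ] EuclideanSpace ℝ (Fin n)) →ₗ[ℝ] (H ⊗[ℝ] EuclideanSpace ℝ (Fin n)) :=
  LinearMap.id - linPart A X

/-- The solution set `D_A` of the linear operator inequality `L_A(X) ⪰ 0` among tuples of real
symmetric matrices. -/
def spectrahedron {g : ℕ} (A : Fin g → H →L[ℝ] H) : MatSet g :=
  fun _ => {X | (∀ i, (X i).IsSymm) ∧ (pencil A X).IsPositive}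

end Pencil

/-- `K` is bounded: a single real `C` satisfies `C I - ∑ i, X_i² ⪰ 0` on all levels of `K`. -/
def IsBoundedSet {g : ℕ} (K : MatSet g) : Prop :=
  ∃ C : ℝ, ∀ n : ℕ, ∀ X ∈ K n,
    (C • (1 : Matrix (Fin n) (Fin n) ℝ) - ∑ i, X i ^ 2).PosSemidef

/-- `X` is an Arveson extreme point of `K`: all dilations of `X` in `K` are trivial. -/
def IsArvesonExtreme {g n : ℕ} (K : MatSet g) (X : MatTuple g n n) : Prop :=
  X ∈ K n ∧ ∀ (l : ℕ) (β : MatTuple g n l) (γ : MatTuple g l l),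
    (∀ i, (γ i).IsSymm) → block X β γ ∈ K (n + l) → β = 0

/-- The dilation subspace of `K` at `X`. -/
def dilationSubspace {g n : ℕ} (K : MatSet g) (X : MatTuple g n n) :
    Submodule ℝ (MatTuple g n 1) :=
  Submodule.span ℝ {β | ∃ γ : Fin g → ℝ, block X β (scalarTuple γ) ∈ K (n + 1)}

/-- The set of all `γ ∈ ℝ^g` that complete `X` and `β` to a `1`-dilation in `K`. -/
def gammaSet {g n : ℕ} (K : MatSet g) (X : MatTuple g n n) (β : MatTuple g n 1) :
    Set (Fin g → ℝ) :=
  {γ | block X β (scalarTuple γ) ∈ K (n + 1)}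

/-- `Y` is a maximal `1`-dilation of `X` in `D_A`. -/
def IsMaximalOneDilation {H : Type*} [NormedAddCommGroup H] [InnerProductSpace ℝ H] {g n : ℕ}
    (A : Fin g → H →L[ℝ] H) (X : MatTuple g n n) (Y : MatTuple g (n + 1) (n + 1)) : Prop :=
  Y ∈ spectrahedron A (n + 1) ∧
  ∃ (β : MatTuple g n 1) (γ : Fin g → ℝ),
    Y = block X β (scalarTuple γ) ∧
    β ≠ 0 ∧
    IsGreatest {α : ℝ | ∃ γ' : Fin g → ℝ,
      (pencil A (block X (α • β) (scalarTuple γ'))).IsPositive} 1 ∧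
    γ ∈ Set.extremePoints ℝ (gammaSet (spectrahedron A) X β)

end FreeSpec

end

/-!
Write `Λ = Λ_A(X) ⪯ I`. Since `Λ` is compact, `1` is at most isolated in its spectrum, so adding
a small multiple of a self-adjoint operator that vanishes on `ker (I - Λ)` keeps it below `I`.
Therefore `β` lies in the dilation subspace of `X` exactly when `Λ_A(βᵀ)` vanishes on
`ker (I - Λ)`.

For a maximal `1`-dilation `Y` with corner blocks `β̂` and `γ̂`, deleting the last row maps the
dilation subspace of `Y` into that of `X`. The map is injective: an element supported on the last
row would allow `γ̂` to move in both directions, contradicting extremality. It misses `β̂`: if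
deleting the last row of `b` gives `β̂`, then `Y` dilates along `c b` for some `c > 0`, and rotating
the last two coordinates yields a dilation of `X` along `√(1 + c²) β̂`, contradicting maximality.
Existence of maximal `1`-dilations follows from compactness of the levels of the spectrahedron.
-/

noncomputable section

namespace FreeSpec

section PositiveOperators

open RCLike

variable {𝕜 E : Type*} [RCLike 𝕜] [NormedAddCommGroup E] [InnerProductSpace 𝕜 E]

lemma sq_norm_apply_le_of_isPositive {L : E →L[𝕜] E} (hL : L.IsPositive) (x : E) :
    ‖L x‖ ^ 2 ≤ ‖L‖ * re (inner 𝕜 (L x) x) := by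
  let core : PreInnerProductSpace.Core 𝕜 E :=
    { inner := fun x y => inner 𝕜 (L x) y
      conj_inner_symm := fun x y => by rw [inner_conj_symm, hL.inner_left_eq_inner_right]
      re_inner_nonneg := hL.re_inner_nonneg_left
      add_left := fun x y z => by rw [map_add, inner_add_left]
      smul_left := fun x y c => by rw [map_smul, inner_smul_left] }
  -- Cauchy–Schwarz for the semi-inner product `⟪L x, y⟫`, applied to `x` and `L x`
  have cauchy_schwarz : ‖inner 𝕜 (L x) (L x)‖ * ‖inner 𝕜 (L (L x)) x‖ ≤
      re (inner 𝕜 (L x) x) * re (inner 𝕜 (L (L x)) (L x)) :=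
    InnerProductSpace.Core.inner_mul_inner_self_le (c := core) x (L x)
  have norm_inner : ‖inner 𝕜 (L x) (L x)‖ = ‖L x‖ ^ 2 := by
    rw [inner_self_eq_norm_sq_to_K, norm_pow, norm_ofReal, abs_norm]
  have le_norm : re (inner 𝕜 (L (L x)) (L x)) ≤ ‖L‖ * ‖L x‖ ^ 2 := by
    calc re (inner 𝕜 (L (L x)) (L x)) ≤ ‖L (L x)‖ * ‖L x‖ := re_inner_le_norm _ _
      _ ≤ ‖L‖ * ‖L x‖ * ‖L x‖ := by gcongr; exact L.le_opNorm _
      _ = ‖L‖ * ‖L x‖ ^ 2 := by ring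
  rw [hL.inner_left_eq_inner_right (L x) x, norm_inner] at cauchy_schwarz
  have nonneg := hL.re_inner_nonneg_left x
  rcases (sq_nonneg ‖L x‖).eq_or_lt with h | h
  · rw [← h]; positivity
  · refine le_of_mul_le_mul_right ?_ h
    calc ‖L x‖ ^ 2 * ‖L x‖ ^ 2 ≤ re (inner 𝕜 (L x) x) * (‖L‖ * ‖L x‖ ^ 2) :=
          cauchy_schwarz.trans (mul_le_mul_of_nonneg_left le_norm nonneg)
      _ = ‖L‖ * re (inner 𝕜 (L x) x) * ‖L x‖ ^ 2 := by ring

lemma apply_eq_zero_of_re_inner_eq_zero {L : E →L[𝕜] E} (hL : L.IsPositive) {x : E}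
    (hx : re (inner 𝕜 (L x) x) = 0) : L x = 0 := by
  simpa [hx] using sq_norm_apply_le_of_isPositive hL x

variable [CompleteSpace E]

lemma exists_norm_le_mul_norm_one_sub_apply {T : E →L[𝕜] E} (hT : IsCompactOperator T)
    (hsa : IsSelfAdjoint T) :
    ∃ K : ℝ, ∀ y ∈ (Module.End.eigenspace T.toLinearMap (1 : 𝕜))ᗮ, ‖y‖ ≤ K * ‖(1 - T) y‖ := by
  let N := Module.End.eigenspace T.toLinearMap (1 : 𝕜)
  have invariant : ∀ y ∈ Nᗮ, T y ∈ Nᗮ :=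
    hsa.isSymmetric.invariant_orthogonalComplement_eigenspace 1
  let S : Nᗮ →L[𝕜] Nᗮ := T.restrict invariant
  have hS : IsCompactOperator S := hT.restrict' invariant
  have no_eigenvalue : ¬ Module.End.HasEigenvalue S.toLinearMap (1 : 𝕜) := by
    intro h
    obtain ⟨y, hy, hy0⟩ := h.exists_hasEigenvector
    have : (y : E) ∈ N := by
      rw [Module.End.mem_eigenspace_iff] at hy ⊢
      exact congrArg Subtype.val hy
    exact hy0 (Subtype.ext ((Submodule.disjoint_def.1 N.orthogonal_disjoint) y this y.2))
  obtain ⟨K, hK⟩ := hS.antilipschitz_of_not_hasEigenvalue one_ne_zero no_eigenvalue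
  refine ⟨K, fun y hy => ?_⟩
  simpa [S, norm_sub_rev] using AntilipschitzWith.le_mul_norm hK (map_zero _) ⟨y, hy⟩

/-- Compactness makes `1` at most an isolated point of the spectrum of `T`. -/
lemma exists_fixed_sq_norm_sub_le {T : E →L[𝕜] E} (hT : IsCompactOperator T)
    (hpos : (1 - T).IsPositive) :
    ∃ K : ℝ, 0 ≤ K ∧ ∀ x, ∃ k, T k = k ∧ ‖x - k‖ ^ 2 ≤ K * re (inner 𝕜 ((1 - T) x) x) := by
  have hsa : IsSelfAdjoint T := by
    simpa using (IsSelfAdjoint.one (E →L[𝕜] E)).sub hpos.isSelfAdjoint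
  obtain ⟨K, bound⟩ := exists_norm_le_mul_norm_one_sub_apply hT hsa
  have := T.finite_dimensional_eigenspace hT 1 one_ne_zero
  refine ⟨K ^ 2 * ‖1 - T‖, by positivity, fun x => ?_⟩
  obtain ⟨k, hk, y, hy, rfl⟩ :=
    (Module.End.eigenspace T.toLinearMap (1 : 𝕜)).exists_add_mem_mem_orthogonal x
  have hTk : T k = k := by simpa using Module.End.mem_eigenspace_iff.1 hk
  refine ⟨k, hTk, ?_⟩
  calc ‖k + y - k‖ ^ 2 = ‖y‖ ^ 2 := by rw [add_sub_cancel_left]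
    _ ≤ (K * ‖(1 - T) y‖) ^ 2 := by gcongr; exact bound y hy
    _ = K ^ 2 * ‖(1 - T) (k + y)‖ ^ 2 := by simp [hTk, mul_pow]
    _ ≤ K ^ 2 * (‖1 - T‖ * re (inner 𝕜 ((1 - T) (k + y)) (k + y))) := by
      gcongr; exact sq_norm_apply_le_of_isPositive hpos _
    _ = K ^ 2 * ‖1 - T‖ * re (inner 𝕜 ((1 - T) (k + y)) (k + y)) := (mul_assoc _ _ _).symm

lemma exists_abs_re_inner_le {T S : E →L[𝕜] E} (hT : IsCompactOperator T)
    (hpos : (1 - T).IsPositive) (hS : IsSelfAdjoint S) (hker : ∀ x, T x = x → S x = 0) :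
    ∃ C : ℝ, 0 ≤ C ∧ ∀ x, |re (inner 𝕜 (S x) x)| ≤ C * re (inner 𝕜 ((1 - T) x) x) := by
  obtain ⟨K, hK, gap⟩ := exists_fixed_sq_norm_sub_le hT hpos
  refine ⟨‖S‖ * K, by positivity, fun x => ?_⟩
  obtain ⟨k, hk, hxk⟩ := gap x
  have inner_eq : inner 𝕜 (S x) x = inner 𝕜 (S (x - k)) (x - k) := by
    have : inner 𝕜 (S x) k = 0 := by
      rw [show inner 𝕜 (S x) k = inner 𝕜 x (S k) from hS.isSymmetric x k, hker k hk,
        inner_zero_right]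
    rw [map_sub, hker k hk, sub_zero, inner_sub_right, this, sub_zero]
  calc |re (inner 𝕜 (S x) x)| ≤ ‖S (x - k)‖ * ‖x - k‖ := by
        rw [inner_eq]; exact (abs_re_le_norm _).trans (norm_inner_le_norm _ _)
    _ ≤ ‖S‖ * ‖x - k‖ * ‖x - k‖ := by gcongr; exact S.le_opNorm _
    _ = ‖S‖ * ‖x - k‖ ^ 2 := by ring
    _ ≤ ‖S‖ * (K * re (inner 𝕜 ((1 - T) x) x)) := by gcongr
    _ = ‖S‖ * K * re (inner 𝕜 ((1 - T) x) x) := (mul_assoc _ _ _).symm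

lemma exists_forall_isPositive_sub_smul {T S : E →L[𝕜] E} (hT : IsCompactOperator T)
    (hpos : (1 - T).IsPositive) (hS : IsSelfAdjoint S) (hker : ∀ x, T x = x → S x = 0) :
    ∃ ε > (0 : ℝ), ∀ t : ℝ, |t| ≤ ε → (1 - T - (t : 𝕜) • S).IsPositive := by
  obtain ⟨C, hC, bound⟩ := exists_abs_re_inner_le hT hpos hS hker
  refine ⟨(C + 1)⁻¹, by positivity, fun t ht => ?_⟩
  have hsa : IsSelfAdjoint (1 - T - (t : 𝕜) • S) :=
    hpos.isSelfAdjoint.sub (IsSelfAdjoint.smul (conj_ofReal t : IsSelfAdjoint (t : 𝕜)) hS)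
  refine ContinuousLinearMap.isPositive_def'.2 ⟨hsa, fun x => ?_⟩
  have nonneg := hpos.re_inner_nonneg_left x
  have : |t * re (inner 𝕜 (S x) x)| ≤ re (inner 𝕜 ((1 - T) x) x) := by
    calc |t * re (inner 𝕜 (S x) x)| = |t| * |re (inner 𝕜 (S x) x)| := abs_mul _ _
      _ ≤ (C + 1)⁻¹ * (C * re (inner 𝕜 ((1 - T) x) x)) := by gcongr; exact bound x
      _ ≤ (C + 1)⁻¹ * ((C + 1) * re (inner 𝕜 ((1 - T) x) x)) := by gcongr; linarith
      _ = re (inner 𝕜 ((1 - T) x) x) := inv_mul_cancel_left₀ (by positivity) _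
  have expand : (1 - T - (t : 𝕜) • S).reApplyInnerSelf x =
      re (inner 𝕜 ((1 - T) x) x) - t * re (inner 𝕜 (S x) x) := by
    rw [ContinuousLinearMap.reApplyInnerSelf_apply, sub_apply, inner_sub_left,
      map_sub, smul_apply, inner_smul_left, conj_ofReal, re_ofReal_mul]
  rw [expand, sub_nonneg]
  exact (le_abs_self _).trans this

end PositiveOperators

lemma isCompactOperator_pi {M κ : Type*} [Zero M] [TopologicalSpace M] [Finite κ]
    {F : κ → Type*} [∀ a, TopologicalSpace (F a)] {f : M → ∀ a, F a}
    (hf : ∀ a, IsCompactOperator fun x => f x a) : IsCompactOperator f := by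
  choose K hK hKf using hf
  refine ⟨Set.univ.pi K, isCompact_univ_pi hK, ?_⟩
  filter_upwards [Filter.eventually_all.2 hKf] with x hx a _ using hx a

section Ampliation

variable {𝕜 E F G ι κ μ : Type*} [NontriviallyNormedField 𝕜] [NormedAddCommGroup E]
  [NormedSpace 𝕜 E] [NormedAddCommGroup F] [NormedSpace 𝕜 F] [NormedAddCommGroup G]
  [NormedSpace 𝕜 G] [Fintype ι]

/-- The ampliation `T ⊗ M : E ⊗ 𝕜^ι → F ⊗ 𝕜^κ` of an operator `T` by a matrix `M`, with `E ⊗ 𝕜^ι`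
realised as the `ℓ²` sum of copies of `E` indexed by `ι`. -/
def ampliation (T : E →L[𝕜] F) (M : Matrix κ ι 𝕜) :
    PiLp 2 (fun _ : ι => E) →L[𝕜] PiLp 2 (fun _ : κ => F) :=
  (PiLp.continuousLinearEquiv 2 𝕜 fun _ : κ => F).symm.toContinuousLinearMap ∘L
    ContinuousLinearMap.pi fun a => ∑ b, M a b • T ∘L PiLp.proj 2 _ b

lemma ampliation_apply (T : E →L[𝕜] F) (M : Matrix κ ι 𝕜) (x : PiLp 2 (fun _ : ι => E)) (a : κ) :
    ampliation T M x a = ∑ b, M a b • T (x b) := by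
  simp [ampliation]

lemma ampliation_add [Fintype κ] (T : E →L[𝕜] F) (M N : Matrix κ ι 𝕜) :
    ampliation T (M + N) = ampliation T M + ampliation T N := by
  ext x a
  simp [ampliation_apply, add_smul, Finset.sum_add_distrib]

lemma ampliation_smul [Fintype κ] (T : E →L[𝕜] F) (c : 𝕜) (M : Matrix κ ι 𝕜) :
    ampliation T (c • M) = c • ampliation T M := by
  ext x a
  simp [ampliation_apply, mul_smul, Finset.smul_sum]

lemma ampliation_one [DecidableEq ι] : ampliation (1 : E →L[𝕜] E) (1 : Matrix ι ι 𝕜) = 1 := by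
  ext x a
  simp [ampliation_apply, Matrix.one_apply]

lemma ampliation_mul [Fintype κ] (S : F →L[𝕜] G) (T : E →L[𝕜] F) (M : Matrix μ κ 𝕜)
    (N : Matrix κ ι 𝕜) : ampliation (S ∘L T) (M * N) = ampliation S M ∘L ampliation T N := by
  ext x a
  simp only [ampliation_apply, ContinuousLinearMap.comp_apply, Matrix.mul_apply, map_sum, map_smul,
    Finset.sum_smul, Finset.smul_sum, mul_smul]
  exact Finset.sum_comm

lemma isCompactOperator_ampliation [Finite κ] {T : E →L[𝕜] F} (hT : IsCompactOperator T)
    (M : Matrix κ ι 𝕜) : IsCompactOperator (ampliation T M) := by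
  have hrow (a : κ) : IsCompactOperator
      (∑ b, M a b • T ∘L PiLp.proj 2 (fun _ => E) b : PiLp 2 (fun _ : ι => E) →L[𝕜] F) :=
    (compactOperator (RingHom.id 𝕜) (PiLp 2 fun _ : ι => E) F).sum_mem fun b _ =>
      (IsCompactOperator.comp_clm hT (PiLp.proj (𝕜 := 𝕜) 2 (fun _ => E) b)).smul (M a b)
  exact (isCompactOperator_pi hrow).continuous_comp (PiLp.continuous_toLp 2 _)

end Ampliation

section Adjoint

variable {𝕜 E F ι κ : Type*} [RCLike 𝕜] [NormedAddCommGroup E] [InnerProductSpace 𝕜 E]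
  [CompleteSpace E] [NormedAddCommGroup F] [InnerProductSpace 𝕜 F] [CompleteSpace F]
  [Fintype ι] [Fintype κ]

lemma adjoint_ampliation (T : E →L[𝕜] F) (M : Matrix κ ι 𝕜) :
    (ampliation T M).adjoint = ampliation T.adjoint M.conjTranspose := by
  refine ((ContinuousLinearMap.eq_adjoint_iff _ _).2 fun y x => ?_).symm
  simp only [PiLp.inner_apply, ampliation_apply, sum_inner, inner_sum, inner_smul_left,
    inner_smul_right, ContinuousLinearMap.adjoint_inner_left, Matrix.conjTranspose_apply,
    RCLike.star_def, RCLike.conj_conj]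
  exact Finset.sum_comm

end Adjoint

section Tensor

open TensorProduct

variable {𝕜 H ι : Type*} [RCLike 𝕜] [NormedAddCommGroup H] [InnerProductSpace 𝕜 H] [Fintype ι]
  [DecidableEq ι]

/-- The identification of `H ⊗ 𝕜^ι` with the `ℓ²` sum of copies of `H` indexed by `ι`. -/
def tensorEquivPi (𝕜 H ι : Type*) [RCLike 𝕜] [NormedAddCommGroup H] [InnerProductSpace 𝕜 H]
    [Fintype ι] [DecidableEq ι] :
    H ⊗[𝕜] EuclideanSpace 𝕜 ι ≃ₗ[𝕜] PiLp 2 fun _ : ι => H :=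
  (TensorProduct.congr (.refl 𝕜 H) (WithLp.linearEquiv 2 𝕜 (ι → 𝕜))) ≪≫ₗ
    TensorProduct.piScalarRight 𝕜 𝕜 H ι ≪≫ₗ (WithLp.linearEquiv 2 𝕜 (ι → H)).symm

@[simp]
lemma tensorEquivPi_tmul (h : H) (e : EuclideanSpace 𝕜 ι) (a : ι) :
    tensorEquivPi 𝕜 H ι (h ⊗ₜ e) a = e a • h := by
  simp [tensorEquivPi]

lemma inner_tensorEquivPi (s t : H ⊗[𝕜] EuclideanSpace 𝕜 ι) :
    inner 𝕜 (tensorEquivPi 𝕜 H ι s) (tensorEquivPi 𝕜 H ι t) = inner 𝕜 s t := by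
  induction s with
  | zero => simp
  | add s₁ s₂ h₁ h₂ => rw [map_add, inner_add_left, inner_add_left, h₁, h₂]
  | tmul h e =>
    induction t with
    | zero => simp
    | add t₁ t₂ h₁ h₂ => rw [map_add, inner_add_right, inner_add_right, h₁, h₂]
    | tmul k f =>
      simp only [PiLp.inner_apply, tensorEquivPi_tmul, inner_smul_left, inner_smul_right,
        inner_tmul, Finset.mul_sum, RCLike.inner_apply]
      exact Finset.sum_congr rfl fun a _ => by ring

lemma tensorEquivPi_map (T : H →L[𝕜] H) (M : Matrix ι ι 𝕜) (t : H ⊗[𝕜] EuclideanSpace 𝕜 ι) :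
    tensorEquivPi 𝕜 H ι (TensorProduct.map T.toLinearMap (Matrix.toEuclideanLin M) t) =
      ampliation T M (tensorEquivPi 𝕜 H ι t) := by
  induction t with
  | zero => simp
  | add s t hs ht => rw [map_add, map_add, map_add, map_add, hs, ht]
  | tmul h e =>
    ext a
    simp [ampliation_apply, Matrix.mulVec, dotProduct, Finset.sum_smul, mul_smul]

end Tensor

section LinOp

variable {H : Type*} [NormedAddCommGroup H] [InnerProductSpace ℝ H] {g k l m n : ℕ}

/-- The operator `I_H ⊗ U : H ⊗ ℝⁿ → H ⊗ ℝᵐ`. -/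
abbrev coeffOp (H : Type*) [NormedAddCommGroup H] [InnerProductSpace ℝ H]
    (U : Matrix (Fin m) (Fin n) ℝ) :
    PiLp 2 (fun _ : Fin n => H) →L[ℝ] PiLp 2 (fun _ : Fin m => H) :=
  ampliation (ContinuousLinearMap.id ℝ H) U

/-- The linear part `Λ_A(β) = ∑ i, A i ⊗ β i` of the pencil, extended to rectangular tuples. -/
def linOp (A : Fin g → H →L[ℝ] H) :
    MatTuple g m n →ₗ[ℝ] PiLp 2 (fun _ : Fin n => H) →L[ℝ] PiLp 2 (fun _ : Fin m => H) where
  toFun β := ∑ i, ampliation (A i) (β i)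
  map_add' β δ := by simp only [Pi.add_apply, ampliation_add, Finset.sum_add_distrib]
  map_smul' c β := by simp only [Pi.smul_apply, ampliation_smul, Finset.smul_sum, RingHom.id_apply]

lemma linOp_apply (A : Fin g → H →L[ℝ] H) (β : MatTuple g m n) :
    linOp A β = ∑ i, ampliation (A i) (β i) := rfl

lemma coeffOp_one : coeffOp H (1 : Matrix (Fin n) (Fin n) ℝ) = 1 := ampliation_one

lemma coeffOp_zero : coeffOp H (0 : Matrix (Fin m) (Fin n) ℝ) = 0 := by
  ext x a
  simp [ampliation_apply]

lemma coeffOp_coeffOp (U : Matrix (Fin k) (Fin m) ℝ) (V : Matrix (Fin m) (Fin n) ℝ)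
    (x : PiLp 2 fun _ : Fin n => H) : coeffOp H U (coeffOp H V x) = coeffOp H (U * V) x := by
  rw [← ContinuousLinearMap.comp_apply, ← ampliation_mul, ContinuousLinearMap.id_comp]

lemma linOp_mul_left (A : Fin g → H →L[ℝ] H) (U : Matrix (Fin k) (Fin m) ℝ) (β : MatTuple g m n) :
    linOp A (fun i => U * β i) = coeffOp H U ∘L linOp A β := by
  simp only [linOp_apply, ContinuousLinearMap.comp_finsetSum, ← ampliation_mul,
    ContinuousLinearMap.id_comp]

lemma linOp_mul_right (A : Fin g → H →L[ℝ] H) (β : MatTuple g m n) (V : Matrix (Fin n) (Fin k) ℝ) :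
    linOp A (fun i => β i * V) = linOp A β ∘L coeffOp H V := by
  simp only [linOp_apply, ContinuousLinearMap.finsetSum_comp, ← ampliation_mul,
    ContinuousLinearMap.comp_id]

lemma isCompactOperator_linOp {A : Fin g → H →L[ℝ] H} (hA : ∀ i, IsCompactOperator (A i))
    (β : MatTuple g m n) : IsCompactOperator (linOp A β) :=
  (compactOperator (RingHom.id ℝ) _ _).sum_mem fun i _ => isCompactOperator_ampliation (hA i) (β i)

lemma tensorEquivPi_pencil (A : Fin g → H →L[ℝ] H) (X : MatTuple g n n)
    (t : H ⊗[ℝ] EuclideanSpace ℝ (Fin n)) :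
    tensorEquivPi ℝ H (Fin n) (pencil A X t) = (1 - linOp A X) (tensorEquivPi ℝ H (Fin n) t) := by
  simp [pencil, linPart, linOp_apply, tensorEquivPi_map]

lemma pencil_isPositive_iff (A : Fin g → H →L[ℝ] H) (X : MatTuple g n n) :
    (pencil A X).IsPositive ↔ (1 - linOp A X).IsPositive := by
  let e := (tensorEquivPi ℝ H (Fin n)).isometryOfInner inner_tensorEquivPi
  have conj : e.toLinearMap ∘ₗ pencil A X ∘ₗ e.symm.toLinearMap = (1 - linOp A X).toLinearMap := by
    ext1 x
    simpa [e] using tensorEquivPi_pencil A X ((tensorEquivPi ℝ H (Fin n)).symm x)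
  rw [← ContinuousLinearMap.isPositive_toLinearMap_iff, ← conj]
  exact (LinearMap.isPositive_linearIsometryEquiv_conj_iff e).symm

lemma mem_spectrahedron_iff {A : Fin g → H →L[ℝ] H} {X : MatTuple g n n} :
    X ∈ spectrahedron A n ↔ (∀ i, (X i).IsSymm) ∧ (1 - linOp A X).IsPositive :=
  and_congr_right' (pencil_isPositive_iff A X)

variable [CompleteSpace H]

lemma adjoint_coeffOp (U : Matrix (Fin m) (Fin n) ℝ) :
    (coeffOp H U).adjoint = coeffOp H U.transpose := by
  rw [adjoint_ampliation, ContinuousLinearMap.adjoint_id,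
    Matrix.conjTranspose_eq_transpose_of_trivial]

lemma adjoint_linOp {A : Fin g → H →L[ℝ] H} (hA : ∀ i, IsSelfAdjoint (A i)) (β : MatTuple g m n) :
    (linOp A β).adjoint = linOp A fun i => (β i).transpose := by
  simp only [linOp_apply, map_sum, adjoint_ampliation, (hA _).adjoint_eq,
    Matrix.conjTranspose_eq_transpose_of_trivial]

lemma isSelfAdjoint_linOp {A : Fin g → H →L[ℝ] H} (hA : ∀ i, IsSelfAdjoint (A i))
    {X : MatTuple g n n} (hX : ∀ i, (X i).IsSymm) : IsSelfAdjoint (linOp A X) := by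
  rw [ContinuousLinearMap.isSelfAdjoint_iff', adjoint_linOp hA]
  exact congrArg _ (funext hX)

lemma one_sub_linOp_conj (A : Fin g → H →L[ℝ] H) (Y : MatTuple g m m)
    {V : Matrix (Fin m) (Fin n) ℝ} (hV : V.transpose * V = 1) :
    1 - linOp A (fun i => V.transpose * Y i * V) =
      (coeffOp H V).adjoint ∘L (1 - linOp A Y) ∘L coeffOp H V := by
  ext1 x
  simp only [linOp_mul_right, linOp_mul_left, adjoint_coeffOp, ContinuousLinearMap.comp_apply,
    sub_apply, one_apply_eq_self, map_sub, coeffOp_coeffOp, hV, coeffOp_one]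

lemma conj_mem_spectrahedron {A : Fin g → H →L[ℝ] H} {Y : MatTuple g m m}
    (hY : Y ∈ spectrahedron A m) {V : Matrix (Fin m) (Fin n) ℝ} (hV : V.transpose * V = 1) :
    (fun i => V.transpose * Y i * V) ∈ spectrahedron A n := by
  rw [mem_spectrahedron_iff] at hY ⊢
  refine ⟨fun i => ?_, one_sub_linOp_conj A Y hV ▸ hY.2.adjoint_conj _⟩
  rw [Matrix.IsSymm, Matrix.transpose_mul, Matrix.transpose_mul, (hY.1 i).eq,
    Matrix.transpose_transpose, Matrix.mul_assoc]

lemma exists_forall_add_smul_mem_spectrahedron {A : Fin g → H →L[ℝ] H}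
    (hA : ∀ i, IsSelfAdjoint (A i)) (hAc : ∀ i, IsCompactOperator (A i))
    {Y Z : MatTuple g n n} (hY : Y ∈ spectrahedron A n) (hZ : ∀ i, (Z i).IsSymm)
    (hker : ∀ x, linOp A Y x = x → linOp A Z x = 0) :
    ∃ ε > (0 : ℝ), ∀ t : ℝ, |t| ≤ ε → Y + t • Z ∈ spectrahedron A n := by
  rw [mem_spectrahedron_iff] at hY
  obtain ⟨ε, hε, hpos⟩ := exists_forall_isPositive_sub_smul (isCompactOperator_linOp hAc Y) hY.2
    (isSelfAdjoint_linOp hA hZ) hker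
  refine ⟨ε, hε, fun t ht => mem_spectrahedron_iff.2
    ⟨fun i => (hY.1 i).add ((hZ i).smul t), ?_⟩⟩
  simpa only [map_add, map_smul, sub_sub, RCLike.ofReal_real_eq_id, id] using hpos t ht

end LinOp

section Block

open Matrix

variable {g k l m n : ℕ}

/-- The isometric inclusion of `ℝⁿ` as the first summand of `ℝⁿ⁺ˡ = ℝⁿ ⊕ ℝˡ`. -/
def inlMatrix (n l : ℕ) : Matrix (Fin (n + l)) (Fin n) ℝ :=
  (fromRows 1 0).submatrix finSumFinEquiv.symm id

/-- The isometric inclusion of `ℝˡ` as the second summand of `ℝⁿ⁺ˡ = ℝⁿ ⊕ ℝˡ`. -/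
def inrMatrix (n l : ℕ) : Matrix (Fin (n + l)) (Fin l) ℝ :=
  (fromRows 0 1).submatrix finSumFinEquiv.symm id

@[simp]
lemma inl_transpose_mul_inl : (inlMatrix n l)ᵀ * inlMatrix n l = 1 := by
  simp [inlMatrix, transpose_fromRows, fromCols_mul_fromRows]

@[simp]
lemma inr_transpose_mul_inr : (inrMatrix n l)ᵀ * inrMatrix n l = 1 := by
  simp [inrMatrix, transpose_fromRows, fromCols_mul_fromRows]

@[simp]
lemma inl_transpose_mul_inr : (inlMatrix n l)ᵀ * inrMatrix n l = 0 := by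
  simp [inlMatrix, inrMatrix, transpose_fromRows, fromCols_mul_fromRows]

@[simp]
lemma inr_transpose_mul_inl : (inrMatrix n l)ᵀ * inlMatrix n l = 0 := by
  simp [inlMatrix, inrMatrix, transpose_fromRows, fromCols_mul_fromRows]

@[simp]
lemma inl_transpose_mul_inl_mul (M : Matrix (Fin n) (Fin k) ℝ) :
    (inlMatrix n l)ᵀ * (inlMatrix n l * M) = M := by
  rw [← Matrix.mul_assoc, inl_transpose_mul_inl, Matrix.one_mul]

@[simp]
lemma inr_transpose_mul_inl_mul (M : Matrix (Fin n) (Fin k) ℝ) :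
    (inrMatrix n l)ᵀ * (inlMatrix n l * M) = 0 := by
  rw [← Matrix.mul_assoc, inr_transpose_mul_inl, Matrix.zero_mul]

@[simp]
lemma inl_transpose_mul_inr_mul (M : Matrix (Fin l) (Fin k) ℝ) :
    (inlMatrix n l)ᵀ * (inrMatrix n l * M) = 0 := by
  rw [← Matrix.mul_assoc, inl_transpose_mul_inr, Matrix.zero_mul]

@[simp]
lemma inr_transpose_mul_inr_mul (M : Matrix (Fin l) (Fin k) ℝ) :
    (inrMatrix n l)ᵀ * (inrMatrix n l * M) = M := by
  rw [← Matrix.mul_assoc, inr_transpose_mul_inr, Matrix.one_mul]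

lemma block_apply_eq (X : MatTuple g n n) (β : MatTuple g n l) (γ : MatTuple g l l) (i : Fin g) :
    block X β γ i =
      inlMatrix n l * X i * (inlMatrix n l)ᵀ + inlMatrix n l * β i * (inrMatrix n l)ᵀ +
        (inrMatrix n l * (β i)ᵀ * (inlMatrix n l)ᵀ + inrMatrix n l * γ i * (inrMatrix n l)ᵀ) := by
  ext a b
  induction a using Fin.addCases <;> induction b using Fin.addCases <;>
    simp [block, inlMatrix, inrMatrix, mul_apply, one_apply]

lemma inl_mul_transpose_add_inr_mul_transpose :
    inlMatrix n l * (inlMatrix n l)ᵀ + inrMatrix n l * (inrMatrix n l)ᵀ = 1 := by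
  simpa [block] using
    (block_apply_eq (g := 1) (fun _ => 1) (0 : MatTuple 1 n l) (fun _ => 1) 0).symm

lemma block_mul_inl (X : MatTuple g n n) (β : MatTuple g n l) (γ : MatTuple g l l) (i : Fin g) :
    block X β γ i * inlMatrix n l = inlMatrix n l * X i + inrMatrix n l * (β i)ᵀ := by
  simp [block_apply_eq, Matrix.add_mul, Matrix.mul_assoc]

lemma block_mul_inr (X : MatTuple g n n) (β : MatTuple g n l) (γ : MatTuple g l l) (i : Fin g) :
    block X β γ i * inrMatrix n l = inlMatrix n l * β i + inrMatrix n l * γ i := by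
  simp [block_apply_eq, Matrix.add_mul, Matrix.mul_assoc]

lemma inl_transpose_mul_block_mul_inl (X : MatTuple g n n) (β : MatTuple g n l)
    (γ : MatTuple g l l) (i : Fin g) :
    (inlMatrix n l)ᵀ * block X β γ i * inlMatrix n l = X i := by
  simp [Matrix.mul_assoc, block_mul_inl, Matrix.mul_add]

lemma inl_transpose_mul_block_mul_inr (X : MatTuple g n n) (β : MatTuple g n l)
    (γ : MatTuple g l l) (i : Fin g) :
    (inlMatrix n l)ᵀ * block X β γ i * inrMatrix n l = β i := by
  simp [Matrix.mul_assoc, block_mul_inr, Matrix.mul_add]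

lemma inr_transpose_mul_block_mul_inr (X : MatTuple g n n) (β : MatTuple g n l)
    (γ : MatTuple g l l) (i : Fin g) :
    (inrMatrix n l)ᵀ * block X β γ i * inrMatrix n l = γ i := by
  simp [Matrix.mul_assoc, block_mul_inr, Matrix.mul_add]

lemma block_isSymm {X : MatTuple g n n} {γ : MatTuple g l l} (hX : ∀ i, (X i).IsSymm)
    (β : MatTuple g n l) (hγ : ∀ i, (γ i).IsSymm) (i : Fin g) : (block X β γ i).IsSymm :=
  ((hX i).fromBlocks rfl (hγ i)).submatrix _

lemma block_add (X X' : MatTuple g n n) (β β' : MatTuple g n l) (γ γ' : MatTuple g l l) :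
    block (X + X') (β + β') (γ + γ') = block X β γ + block X' β' γ' := by
  funext i
  simp [block, ← fromBlocks_add, submatrix_add]

lemma block_smul (c : ℝ) (X : MatTuple g n n) (β : MatTuple g n l) (γ : MatTuple g l l) :
    block (c • X) (c • β) (c • γ) = c • block X β γ := by
  funext i
  simp [block, ← fromBlocks_smul, submatrix_smul]

lemma conj_add_eq_block {Z : MatTuple g m m} (hZ : ∀ i, (Z i).IsSymm)
    (U : Matrix (Fin m) (Fin n) ℝ) (W : Matrix (Fin m) (Fin l) ℝ) :
    (fun i => (U * (inlMatrix n l)ᵀ + W * (inrMatrix n l)ᵀ)ᵀ * Z i *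
      (U * (inlMatrix n l)ᵀ + W * (inrMatrix n l)ᵀ)) =
      block (fun i => Uᵀ * Z i * U) (fun i => Uᵀ * Z i * W) (fun i => Wᵀ * Z i * W) := by
  funext i
  simp only [block_apply_eq, transpose_add, transpose_mul, transpose_transpose, (hZ i).eq,
    Matrix.add_mul, Matrix.mul_add, Matrix.mul_assoc]
  abel

lemma scalarTuple_zero : scalarTuple (0 : Fin g → ℝ) = 0 := rfl

lemma scalarTuple_add (γ δ : Fin g → ℝ) : scalarTuple (γ + δ) = scalarTuple γ + scalarTuple δ :=
  rfl

lemma scalarTuple_smul (c : ℝ) (γ : Fin g → ℝ) : scalarTuple (c • γ) = c • scalarTuple γ := by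
  ext; rfl

lemma scalarTuple_isSymm (γ : Fin g → ℝ) (i : Fin g) : (scalarTuple γ i).IsSymm := rfl

lemma scalarTuple_surjective : Function.Surjective (scalarTuple : (Fin g → ℝ) → MatTuple g 1 1) :=
  fun δ => ⟨fun i => δ i 0 0, by ext i a b; simp [scalarTuple, Subsingleton.elim _ (0 : Fin 1)]⟩

end Block

section Spectrahedron

open Matrix

variable {H : Type*} [NormedAddCommGroup H] [InnerProductSpace ℝ H]
  {g l m n : ℕ} {A : Fin g → H →L[ℝ] H} {X : MatTuple g n n}

lemma linOp_block (X : MatTuple g n n) (β : MatTuple g n l) (γ : MatTuple g l l)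
    (w : PiLp 2 fun _ : Fin (n + l) => H) :
    linOp A (block X β γ) w =
      coeffOp H (inlMatrix n l) (linOp A X (coeffOp H (inlMatrix n l)ᵀ w) +
        linOp A β (coeffOp H (inrMatrix n l)ᵀ w)) +
      coeffOp H (inrMatrix n l) (linOp A (fun i => (β i)ᵀ) (coeffOp H (inlMatrix n l)ᵀ w) +
        linOp A γ (coeffOp H (inrMatrix n l)ᵀ w)) := by
  have block_eq : block X β γ =
      (fun i => inlMatrix n l * (X i * (inlMatrix n l)ᵀ)) +
        (fun i => inlMatrix n l * (β i * (inrMatrix n l)ᵀ)) +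
      ((fun i => inrMatrix n l * ((β i)ᵀ * (inlMatrix n l)ᵀ)) +
        fun i => inrMatrix n l * (γ i * (inrMatrix n l)ᵀ)) := by
    funext i
    simp only [block_apply_eq, Matrix.mul_assoc, Pi.add_apply]
  simp only [block_eq, map_add, linOp_mul_left, linOp_mul_right, _root_.add_apply,
    ContinuousLinearMap.comp_apply]

lemma linOp_block_zero (X : MatTuple g n n) (w : PiLp 2 fun _ : Fin (n + l) => H) :
    linOp A (block X 0 (0 : MatTuple g l l)) w =
      coeffOp H (inlMatrix n l) (linOp A X (coeffOp H (inlMatrix n l)ᵀ w)) := by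
  have transpose_zero : linOp A (fun i => ((0 : MatTuple g n l) i)ᵀ) = 0 := map_zero _
  simp only [linOp_block, transpose_zero, map_zero, _root_.zero_apply, add_zero]

lemma coeffOp_inl_add_coeffOp_inr (w : PiLp 2 fun _ : Fin (n + l) => H) :
    coeffOp H (inlMatrix n l) (coeffOp H (inlMatrix n l)ᵀ w) +
      coeffOp H (inrMatrix n l) (coeffOp H (inrMatrix n l)ᵀ w) = w := by
  rw [coeffOp_coeffOp, coeffOp_coeffOp, ← _root_.add_apply, ← ampliation_add,
    inl_mul_transpose_add_inr_mul_transpose]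
  exact congrArg (· w) coeffOp_one

variable [CompleteSpace H]

lemma linOp_coeffOp_of_conj {Y : MatTuple g m m} (hY : Y ∈ spectrahedron A m)
    {V : Matrix (Fin m) (Fin n) ℝ} (hV : Vᵀ * V = 1) {x : PiLp 2 fun _ : Fin n => H}
    (hx : linOp A (fun i => Vᵀ * Y i * V) x = x) :
    linOp A Y (coeffOp H V x) = coeffOp H V x := by
  have conj_apply : (coeffOp H V).adjoint ((1 - linOp A Y) (coeffOp H V x)) = 0 := by
    calc (coeffOp H V).adjoint ((1 - linOp A Y) (coeffOp H V x))
        = (1 - linOp A (fun i => Vᵀ * Y i * V)) x := by rw [one_sub_linOp_conj A Y hV]; rfl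
      _ = 0 := by simp [hx]
  have inner_eq_zero : inner ℝ ((1 - linOp A Y) (coeffOp H V x)) (coeffOp H V x) = 0 := by
    rw [← ContinuousLinearMap.adjoint_inner_left, conj_apply, inner_zero_left]
  exact (sub_eq_zero.1
    (apply_eq_zero_of_re_inner_eq_zero (mem_spectrahedron_iff.1 hY).2 inner_eq_zero)).symm

lemma block_mem_of_orthonormal {Z : MatTuple g m m} (hZ : Z ∈ spectrahedron A m)
    {U : Matrix (Fin m) (Fin n) ℝ} {W : Matrix (Fin m) (Fin l) ℝ} (hU : Uᵀ * U = 1)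
    (hW : Wᵀ * W = 1) (hUW : Uᵀ * W = 0) :
    block (fun i => Uᵀ * Z i * U) (fun i => Uᵀ * Z i * W) (fun i => Wᵀ * Z i * W) ∈
      spectrahedron A (n + l) := by
  have hWU : Wᵀ * U = 0 := by simpa using congrArg transpose hUW
  rw [← conj_add_eq_block hZ.1]
  refine conj_mem_spectrahedron hZ ?_
  calc (U * (inlMatrix n l)ᵀ + W * (inrMatrix n l)ᵀ)ᵀ *
        (U * (inlMatrix n l)ᵀ + W * (inrMatrix n l)ᵀ)
      = inlMatrix n l * (Uᵀ * U) * (inlMatrix n l)ᵀ +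
          inrMatrix n l * (Wᵀ * U) * (inlMatrix n l)ᵀ +
          (inlMatrix n l * (Uᵀ * W) * (inrMatrix n l)ᵀ +
            inrMatrix n l * (Wᵀ * W) * (inrMatrix n l)ᵀ) := by
        simp only [transpose_add, transpose_mul, transpose_transpose, Matrix.add_mul,
          Matrix.mul_add, Matrix.mul_assoc]
    _ = 1 := by simp [hU, hW, hUW, hWU, inl_mul_transpose_add_inr_mul_transpose]

lemma linOp_coeffOp_inl_of_block_mem {β : MatTuple g n l} {γ : MatTuple g l l}
    (hY : block X β γ ∈ spectrahedron A (n + l)) {x : PiLp 2 fun _ : Fin n => H}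
    (hx : linOp A X x = x) :
    linOp A (block X β γ) (coeffOp H (inlMatrix n l) x) = coeffOp H (inlMatrix n l) x :=
  linOp_coeffOp_of_conj hY inl_transpose_mul_inl (by simpa only [inl_transpose_mul_block_mul_inl])

lemma linOp_transpose_eq_zero_of_block_mem {β : MatTuple g n l} {γ : MatTuple g l l}
    (hY : block X β γ ∈ spectrahedron A (n + l)) {x : PiLp 2 fun _ : Fin n => H}
    (hx : linOp A X x = x) : linOp A (fun i => (β i)ᵀ) x = 0 := by
  simpa [linOp_block, coeffOp_coeffOp, coeffOp_one, coeffOp_zero] using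
    congrArg (coeffOp H (inrMatrix n l)ᵀ) (linOp_coeffOp_inl_of_block_mem hY hx)

lemma block_zero_mem (hX : X ∈ spectrahedron A n) (l : ℕ) :
    block X 0 (0 : MatTuple g l l) ∈ spectrahedron A (n + l) := by
  refine mem_spectrahedron_iff.2 ⟨block_isSymm hX.1 _ fun _ => isSymm_zero, ?_⟩
  have decomposition : 1 - linOp A (block X 0 (0 : MatTuple g l l)) =
      coeffOp H (inlMatrix n l) ∘L (1 - linOp A X) ∘L (coeffOp H (inlMatrix n l)).adjoint +
      coeffOp H (inrMatrix n l) ∘L 1 ∘L (coeffOp H (inrMatrix n l)).adjoint := by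
    ext1 w
    calc w - linOp A (block X 0 0) w
        = coeffOp H (inlMatrix n l) (coeffOp H (inlMatrix n l)ᵀ w) +
            coeffOp H (inrMatrix n l) (coeffOp H (inrMatrix n l)ᵀ w) -
            coeffOp H (inlMatrix n l) (linOp A X (coeffOp H (inlMatrix n l)ᵀ w)) := by
          rw [coeffOp_inl_add_coeffOp_inr, linOp_block_zero]
      _ = _ := by
          simp only [adjoint_coeffOp, _root_.add_apply, ContinuousLinearMap.comp_apply,
            _root_.sub_apply, one_apply_eq_self, map_sub]
          abel
  rw [decomposition]
  exact ((mem_spectrahedron_iff.1 hX).2.conj_adjoint _).add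
    (ContinuousLinearMap.isPositive_one.conj_adjoint _)

lemma exists_smul_block_mem (hA : ∀ i, IsSelfAdjoint (A i)) (hAc : ∀ i, IsCompactOperator (A i))
    (hX : X ∈ spectrahedron A n) {β : MatTuple g n l}
    (hβ : ∀ x, linOp A X x = x → linOp A (fun i => (β i)ᵀ) x = 0) :
    ∃ c > (0 : ℝ), block X (c • β) 0 ∈ spectrahedron A (n + l) := by
  have hker : ∀ w, linOp A (block X 0 (0 : MatTuple g l l)) w = w →
      linOp A (block 0 β 0) w = 0 := by
    intro w hw
    have inr_eq_zero : coeffOp H (inrMatrix n l)ᵀ w = 0 := by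
      rw [← hw, linOp_block_zero, coeffOp_coeffOp, inr_transpose_mul_inl, coeffOp_zero,
        _root_.zero_apply]
    have inl_fixed : linOp A X (coeffOp H (inlMatrix n l)ᵀ w) = coeffOp H (inlMatrix n l)ᵀ w := by
      conv_rhs => rw [← hw, linOp_block_zero, coeffOp_coeffOp, inl_transpose_mul_inl, coeffOp_one,
        one_apply_eq_self]
    simp [linOp_block, inr_eq_zero, hβ _ inl_fixed]
  have hsymm : ∀ i, (block 0 β (0 : MatTuple g l l) i).IsSymm :=
    block_isSymm (X := 0) (γ := 0) (fun _ => isSymm_zero) β fun _ => isSymm_zero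
  obtain ⟨ε, hε, hmem⟩ := exists_forall_add_smul_mem_spectrahedron hA hAc (block_zero_mem hX l)
    hsymm hker
  refine ⟨ε, hε, ?_⟩
  simpa [← block_smul, ← block_add] using hmem ε (abs_of_pos hε).le

theorem mem_dilationSubspace_iff (hA : ∀ i, IsSelfAdjoint (A i))
    (hAc : ∀ i, IsCompactOperator (A i)) (hX : X ∈ spectrahedron A n) {β : MatTuple g n 1} :
    β ∈ dilationSubspace (spectrahedron A) X ↔
      ∀ x, linOp A X x = x → linOp A (fun i => (β i)ᵀ) x = 0 := by
  constructor
  · intro hβ x hx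
    induction hβ using Submodule.span_induction with
    | mem β h => exact linOp_transpose_eq_zero_of_block_mem h.choose_spec hx
    | zero => exact congrArg (· x) (map_zero (linOp (m := 1) (n := n) A))
    | add β δ _ _ hβ hδ =>
      have := congrArg (· x) (map_add (linOp A) (fun i => (β i)ᵀ) fun i => (δ i)ᵀ)
      exact this.trans (by simp [hβ, hδ])
    | smul c β _ hβ =>
      have := congrArg (· x) (map_smul (linOp A) c fun i => (β i)ᵀ)
      exact this.trans (by simp [hβ])
  · intro hβ
    obtain ⟨c, hc, hmem⟩ := exists_smul_block_mem hA hAc hX hβ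
    rw [← scalarTuple_zero] at hmem
    rw [← Submodule.smul_mem_iff _ hc.ne']
    exact Submodule.subset_span ⟨0, hmem⟩

end Spectrahedron

lemma eq_zero_of_mem_extremePoints {𝕜 E : Type*} [Field 𝕜] [LinearOrder 𝕜] [IsStrictOrderedRing 𝕜]
    [AddCommGroup E] [Module 𝕜 E] {S : Set E} {x v : E} (hx : x ∈ S.extremePoints 𝕜)
    (hadd : x + v ∈ S) (hsub : x - v ∈ S) : v = 0 := by
  have mid : x ∈ openSegment 𝕜 (x + v) (x - v) :=
    ⟨2⁻¹, 2⁻¹, by positivity, by positivity, by norm_num, by module⟩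
  exact add_eq_left.1 (hx.2 hadd hsub mid)

section DimensionDrop

open Matrix

variable {H : Type*} [NormedAddCommGroup H] [InnerProductSpace ℝ H] [CompleteSpace H]
  {g l m n : ℕ} {A : Fin g → H →L[ℝ] H} {X : MatTuple g n n}

/-- The first `n` rows of a tuple of `(n + l) × m` matrices. -/
def topRows : MatTuple g (n + l) m →ₗ[ℝ] MatTuple g n m where
  toFun b i := (inlMatrix n l)ᵀ * b i
  map_add' b c := funext fun i => Matrix.mul_add _ (b i) (c i)
  map_smul' r b := funext fun i => Matrix.mul_smul _ r (b i)

lemma topRows_apply (b : MatTuple g (n + l) m) (i : Fin g) :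
    topRows b i = (inlMatrix n l)ᵀ * b i := rfl

lemma topRows_mem_dilationSubspace (hA : ∀ i, IsSelfAdjoint (A i))
    (hAc : ∀ i, IsCompactOperator (A i)) (hX : X ∈ spectrahedron A n) {β : MatTuple g n l}
    {γ : MatTuple g l l} (hY : block X β γ ∈ spectrahedron A (n + l)) {b : MatTuple g (n + l) 1}
    (hb : b ∈ dilationSubspace (spectrahedron A) (block X β γ)) :
    topRows b ∈ dilationSubspace (spectrahedron A) X := by
  rw [mem_dilationSubspace_iff hA hAc hX]
  intro x hx
  simpa only [topRows_apply, transpose_mul, transpose_transpose, linOp_mul_right,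
    ContinuousLinearMap.comp_apply] using
    (mem_dilationSubspace_iff hA hAc hY).1 hb _ (linOp_coeffOp_inl_of_block_mem hY hx)

lemma exists_eq_inr_mul_scalarTuple {b : MatTuple g (n + 1) 1} (h0 : topRows b = 0) :
    ∃ σ, b = fun i => inrMatrix n 1 * scalarTuple σ i := by
  obtain ⟨σ, hσ⟩ := scalarTuple_surjective fun i => (inrMatrix n 1)ᵀ * b i
  refine ⟨σ, funext fun i => ?_⟩
  calc b i = inlMatrix n 1 * topRows b i + inrMatrix n 1 * ((inrMatrix n 1)ᵀ * b i) := by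
        rw [topRows_apply, ← Matrix.mul_assoc, ← Matrix.mul_assoc, ← Matrix.add_mul,
          inl_mul_transpose_add_inr_mul_transpose, Matrix.one_mul]
    _ = inrMatrix n 1 * scalarTuple σ i := by simp [h0, hσ]

lemma eq_zero_of_topRows_eq_zero (hA : ∀ i, IsSelfAdjoint (A i))
    (hAc : ∀ i, IsCompactOperator (A i)) {β : MatTuple g n 1} {γ : Fin g → ℝ}
    (hγ : γ ∈ Set.extremePoints ℝ (gammaSet (spectrahedron A) X β)) {b : MatTuple g (n + 1) 1}
    (hb : b ∈ dilationSubspace (spectrahedron A) (block X β (scalarTuple γ)))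
    (h0 : topRows b = 0) : b = 0 := by
  have hY : block X β (scalarTuple γ) ∈ spectrahedron A (n + 1) := hγ.1
  obtain ⟨σ, b_eq⟩ := exists_eq_inr_mul_scalarTuple h0
  have hker : ∀ w, linOp A (block X β (scalarTuple γ)) w = w →
      linOp A (block (0 : MatTuple g n n) 0 (scalarTuple σ)) w = 0 := by
    intro w hw
    have hσw : linOp A (scalarTuple σ) (coeffOp H (inrMatrix n 1)ᵀ w) = 0 := by
      simpa only [b_eq, transpose_mul, (scalarTuple_isSymm σ _).eq, linOp_mul_right,
        ContinuousLinearMap.comp_apply] using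
        (mem_dilationSubspace_iff hA hAc hY).1 hb w hw
    have transpose_zero : linOp A (fun i => ((0 : MatTuple g n 1) i)ᵀ) = 0 := map_zero _
    simp only [linOp_block, hσw, transpose_zero, map_zero, _root_.zero_apply, add_zero]
  have hsymm : ∀ i, (block (0 : MatTuple g n n) 0 (scalarTuple σ) i).IsSymm :=
    block_isSymm (fun _ => isSymm_zero) 0 (scalarTuple_isSymm σ)
  obtain ⟨ε, hε, hmem⟩ := exists_forall_add_smul_mem_spectrahedron hA hAc hY hsymm hker
  have moved (t : ℝ) (ht : |t| ≤ ε) : γ + t • σ ∈ gammaSet (spectrahedron A) X β := by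
    simpa only [gammaSet, Set.mem_ofPred_eq, scalarTuple_add, scalarTuple_smul, ← block_smul,
      ← block_add, smul_zero, add_zero] using hmem t ht
  have hεσ : ε • σ = 0 := by
    refine eq_zero_of_mem_extremePoints hγ (moved ε (abs_of_pos hε).le) ?_
    simpa only [neg_smul, ← sub_eq_add_neg] using
      moved (-ε) (by rw [abs_neg, abs_of_pos hε])
  have σ_eq : σ = 0 := (smul_eq_zero.1 hεσ).resolve_left hε.ne'
  simp only [b_eq, σ_eq, scalarTuple_zero, Pi.zero_apply, Matrix.mul_zero]
  rfl

/-- Rotate the two complementary summands of a two-step dilation into the direction `(p, q)` and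
discard the orthogonal direction. -/
lemma exists_block_smul_add_smul_topRows_mem {β : MatTuple g n l} {γ δ : MatTuple g l l}
    {b : MatTuple g (n + l) l}
    (hZ : block (block X β γ) b δ ∈ spectrahedron A (n + l + l)) {p q : ℝ}
    (hpq : p ^ 2 + q ^ 2 = 1) :
    ∃ γ', block X (p • β + q • topRows b) γ' ∈ spectrahedron A (n + l) := by
  let K := inlMatrix (n + l) l
  let J := inlMatrix n l
  let W := p • (K * inrMatrix n l) + q • inrMatrix (n + l) l
  have hU : (K * J)ᵀ * (K * J) = 1 := by
    simp [K, J, transpose_mul, Matrix.mul_assoc]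
  have hUW : (K * J)ᵀ * W = 0 := by
    simp [W, K, J, transpose_mul, Matrix.mul_add, Matrix.mul_assoc]
  have hW : Wᵀ * W = 1 := by
    calc Wᵀ * W = (p ^ 2 + q ^ 2) • (1 : Matrix (Fin l) (Fin l) ℝ) := by
          simp [W, K, transpose_add, transpose_mul, Matrix.mul_add, Matrix.add_mul,
            Matrix.mul_assoc, add_smul, smul_smul, sq]
      _ = 1 := by rw [hpq, one_smul]
  have := block_mem_of_orthonormal hZ hU hW hUW
  have corner : (fun i => (K * J)ᵀ * block (block X β γ) b δ i * (K * J)) = X := by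
    funext i
    calc (K * J)ᵀ * block (block X β γ) b δ i * (K * J)
        = Jᵀ * (Kᵀ * block (block X β γ) b δ i * K) * J := by
          simp only [transpose_mul, Matrix.mul_assoc]
      _ = X i := by rw [inl_transpose_mul_block_mul_inl, inl_transpose_mul_block_mul_inl]
  have column : (fun i => (K * J)ᵀ * block (block X β γ) b δ i * W) = p • β + q • topRows b := by
    funext i
    calc (K * J)ᵀ * block (block X β γ) b δ i * W
        = p • (Jᵀ * (Kᵀ * block (block X β γ) b δ i * K) * inrMatrix n l) +
            q • (Jᵀ * (Kᵀ * block (block X β γ) b δ i * inrMatrix (n + l) l)) := by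
          simp only [W, transpose_mul, Matrix.mul_assoc, Matrix.mul_add, Matrix.mul_smul]
      _ = p • β i + q • topRows b i := by
          rw [inl_transpose_mul_block_mul_inl, inl_transpose_mul_block_mul_inr,
            inl_transpose_mul_block_mul_inr, topRows_apply]
  exact ⟨_, corner ▸ column ▸ this⟩

lemma topRows_ne (hA : ∀ i, IsSelfAdjoint (A i)) (hAc : ∀ i, IsCompactOperator (A i))
    {β : MatTuple g n 1} {γ : MatTuple g 1 1} (hY : block X β γ ∈ spectrahedron A (n + 1))
    (hmax : 1 ∈ upperBounds {α : ℝ | ∃ γ' : Fin g → ℝ,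
      (pencil A (block X (α • β) (scalarTuple γ'))).IsPositive}) {b : MatTuple g (n + 1) 1}
    (hb : b ∈ dilationSubspace (spectrahedron A) (block X β γ)) : topRows b ≠ β := by
  intro hbβ
  obtain ⟨c, hc, hZ⟩ := exists_smul_block_mem hA hAc hY ((mem_dilationSubspace_iff hA hAc hY).1 hb)
  have hs : √(1 + c ^ 2) ^ 2 = 1 + c ^ 2 := Real.sq_sqrt (by positivity)
  have hs1 : 1 < √(1 + c ^ 2) := by
    rw [Real.lt_sqrt zero_le_one]
    linarith [pow_pos hc 2]
  set s := √(1 + c ^ 2)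
  obtain ⟨γ', hγ'⟩ := exists_block_smul_add_smul_topRows_mem hZ (p := 1 / s) (q := c / s) (by
    rw [div_pow, div_pow, hs]; field_simp)
  obtain ⟨γ', rfl⟩ := scalarTuple_surjective γ'
  have column : (1 / s) • β + (c / s) • topRows (c • b) = s • β := by
    rw [map_smul, hbβ, smul_smul, ← add_smul]
    congr 1
    field_simp
    exact hs.symm
  rw [column] at hγ'
  exact hs1.not_ge (hmax ⟨γ', hγ'.2⟩)

theorem finrank_dilationSubspace_lt (hA : ∀ i, IsSelfAdjoint (A i))
    (hAc : ∀ i, IsCompactOperator (A i)) (hX : X ∈ spectrahedron A n)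
    {Y : MatTuple g (n + 1) (n + 1)} (hY : IsMaximalOneDilation A X Y) :
    Module.finrank ℝ (dilationSubspace (spectrahedron A) Y) <
      Module.finrank ℝ (dilationSubspace (spectrahedron A) X) := by
  obtain ⟨hmem, β, γ, rfl, -, hmax, hγ⟩ := hY
  let restrict := (topRows (m := 1)).domRestrict
    (dilationSubspace (spectrahedron A) (block X β (scalarTuple γ)))
  have injective : Function.Injective restrict := (injective_iff_map_eq_zero restrict).2
    fun b hb => Subtype.ext (eq_zero_of_topRows_eq_zero hA hAc hγ b.2 hb)
  have range_le : LinearMap.range restrict ≤ dilationSubspace (spectrahedron A) X := by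
    rintro _ ⟨b, rfl⟩
    exact topRows_mem_dilationSubspace hA hAc hX hmem b.2
  have hβ : β ∈ dilationSubspace (spectrahedron A) X := Submodule.subset_span ⟨γ, hmem⟩
  have hβ_range : β ∉ LinearMap.range restrict := by
    rintro ⟨b, hb⟩
    exact topRows_ne hA hAc hmem hmax.2 b.2 hb
  rw [← LinearMap.finrank_range_of_inj injective]
  exact Submodule.finrank_lt_finrank_of_lt
    (SetLike.lt_iff_le_and_exists.2 ⟨range_le, β, hβ, hβ_range⟩)

end DimensionDrop

section Existence

open Matrix

lemma isCompact_preimage_add_linearMap {E F : Type*} [AddCommGroup E] [Module ℝ E]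
    [TopologicalSpace E] [IsTopologicalAddGroup E] [ContinuousSMul ℝ E] [T2Space E]
    [FiniteDimensional ℝ E] [AddCommGroup F] [Module ℝ F] [TopologicalSpace F]
    [IsTopologicalAddGroup F] [ContinuousSMul ℝ F] [T2Space F] {f : E →ₗ[ℝ] F}
    (hf : Function.Injective f) (c : F) {K : Set F} (hK : IsCompact K) :
    IsCompact {x | c + f x ∈ K} := by
  have closedEmbedding : Topology.IsClosedEmbedding fun x => c + f x :=
    (Homeomorph.addLeft c).isClosedEmbedding.comp (LinearMap.isClosedEmbedding_of_injective
      (LinearMap.ker_eq_bot.2 hf))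
  exact closedEmbedding.isCompact_preimage hK

lemma isClosed_setOf_isPositive {𝕜 E : Type*} [RCLike 𝕜] [NormedAddCommGroup E]
    [InnerProductSpace 𝕜 E] [CompleteSpace E] : IsClosed {T : E →L[𝕜] E | T.IsPositive} := by
  simp only [ContinuousLinearMap.isPositive_def', Set.ofPred_and, Set.ofPred_forall,
    ContinuousLinearMap.reApplyInnerSelf_apply]
  refine (isClosed_eq continuous_star continuous_id).inter (isClosed_iInter fun x => ?_)
  exact isClosed_le continuous_const (by fun_prop)

variable {H : Type*} [NormedAddCommGroup H] [InnerProductSpace ℝ H] {g n : ℕ}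

lemma sq_apply_le_of_posSemidef {C : ℝ} {X : MatTuple g n n} (hX : ∀ i, (X i).IsSymm)
    (h : (C • (1 : Matrix (Fin n) (Fin n) ℝ) - ∑ i, X i ^ 2).PosSemidef) (i : Fin g)
    (a b : Fin n) : X i a b ^ 2 ≤ C := by
  have sq_diag (i : Fin g) : (X i ^ 2) a a = ∑ b, X i a b ^ 2 := by
    rw [sq, Matrix.mul_apply]
    exact Finset.sum_congr rfl fun b _ => by rw [(hX i).apply a b, sq]
  have diag_nonneg := h.diag_nonneg (i := a)
  simp only [Matrix.sub_apply, Matrix.smul_apply, Matrix.one_apply_eq, smul_eq_mul, mul_one,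
    Matrix.sum_apply, sq_diag, sub_nonneg] at diag_nonneg
  calc X i a b ^ 2 ≤ ∑ b, X i a b ^ 2 :=
        Finset.single_le_sum (f := fun b => X i a b ^ 2) (fun _ _ => sq_nonneg _)
          (Finset.mem_univ b)
    _ ≤ ∑ i, ∑ b, X i a b ^ 2 :=
        Finset.single_le_sum (f := fun i => ∑ b, X i a b ^ 2)
          (fun _ _ => Finset.sum_nonneg fun _ _ => sq_nonneg _) (Finset.mem_univ i)
    _ ≤ C := diag_nonneg

variable {A : Fin g → H →L[ℝ] H} {X : MatTuple g n n}

variable [CompleteSpace H]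

lemma isClosed_spectrahedron (A : Fin g → H →L[ℝ] H) (n : ℕ) : IsClosed (spectrahedron A n) := by
  have continuous_linOp : Continuous (linOp A : MatTuple g n n →ₗ[ℝ] _) :=
    LinearMap.continuous_of_finiteDimensional _
  have eq : spectrahedron A n =
      {X | ∀ i, (X i).IsSymm} ∩ (fun X => 1 - linOp A X) ⁻¹' {T | T.IsPositive} := by
    ext X
    exact mem_spectrahedron_iff
  rw [eq]
  refine IsClosed.inter ?_ (isClosed_setOf_isPositive.preimage (by fun_prop))
  simp only [Set.ofPred_forall]
  exact isClosed_iInter fun i => isClosed_eq (by fun_prop) (by fun_prop)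

lemma isCompact_spectrahedron (hb : IsBoundedSet (spectrahedron A)) (n : ℕ) :
    IsCompact (spectrahedron A n) := by
  obtain ⟨C, hC⟩ := hb
  have box_compact : IsCompact (Set.univ.pi fun _ : Fin g => Set.univ.pi fun _ : Fin n =>
      Set.univ.pi fun _ : Fin n => Set.Icc (-√C) √C) :=
    isCompact_univ_pi fun _ => isCompact_univ_pi fun _ => isCompact_univ_pi fun _ => isCompact_Icc
  refine box_compact.of_isClosed_subset (isClosed_spectrahedron A n) ?_
  intro X hX i _ a _ b _
  exact abs_le.1 (Real.abs_le_sqrt (sq_apply_le_of_posSemidef hX.1 (hC n X hX) i a b))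

lemma exists_block_scalarTuple_mem (hX : X ∈ spectrahedron A n)
    (hXe : ¬ IsArvesonExtreme (spectrahedron A) X) :
    ∃ β : MatTuple g n 1, β ≠ 0 ∧ ∃ γ, block X β (scalarTuple γ) ∈ spectrahedron A (n + 1) := by
  simp only [IsArvesonExtreme, hX, true_and, not_forall] at hXe
  obtain ⟨l, β, γ, -, hY, hβ⟩ := hXe
  obtain ⟨i, a, j, hij⟩ : ∃ i a j, β i a j ≠ 0 := by
    by_contra! h
    exact hβ (funext fun i => Matrix.ext fun a j => h i a j)
  let e : Matrix (Fin l) (Fin 1) ℝ := (1 : Matrix (Fin l) (Fin l) ℝ).submatrix id fun _ => j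
  have he : eᵀ * e = 1 := by
    ext a b
    simp [e, Matrix.mul_apply, Matrix.one_apply, Subsingleton.elim a b]
  have hW : (inrMatrix n l * e)ᵀ * (inrMatrix n l * e) = 1 := by
    simp [transpose_mul, Matrix.mul_assoc, he]
  have hZ := block_mem_of_orthonormal hY inl_transpose_mul_inl hW (by simp)
  obtain ⟨γ', hγ'⟩ := scalarTuple_surjective
    fun i => (inrMatrix n l * e)ᵀ * block X β γ i * (inrMatrix n l * e)
  rw [← hγ'] at hZ
  simp only [← Matrix.mul_assoc, inl_transpose_mul_block_mul_inl,
    inl_transpose_mul_block_mul_inr] at hZ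
  refine ⟨fun i => β i * e, fun h => hij ?_, γ', hZ⟩
  simpa [e, Matrix.mul_apply, Matrix.one_apply] using congrFun (congrFun (congrFun h i) a) 0

/-- `(α, γ) ↦ (0, αβ, γ)`, the linear part of the affine family of dilations of a tuple along
`β`. -/
def dilationDirection (β : MatTuple g n 1) :
    ℝ × (Fin g → ℝ) →ₗ[ℝ] MatTuple g (n + 1) (n + 1) where
  toFun p := block 0 (p.1 • β) (scalarTuple p.2)
  map_add' p q := by
    simp only [Prod.fst_add, Prod.snd_add, add_smul, scalarTuple_add, ← block_add, add_zero]
  map_smul' c p := by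
    simp only [Prod.smul_fst, Prod.smul_snd, smul_eq_mul, mul_smul, scalarTuple_smul, ← block_smul,
      smul_zero, RingHom.id_apply]

lemma dilationDirection_injective {β : MatTuple g n 1} (hβ : β ≠ 0) :
    Function.Injective (dilationDirection β) := by
  refine (injective_iff_map_eq_zero _).2 fun ⟨α, γ⟩ h => ?_
  have block_eq (i : Fin g) : block (0 : MatTuple g n n) (α • β) (scalarTuple γ) i = 0 :=
    congrFun h i
  have hα : α • β = 0 := funext fun i => by
    rw [← inl_transpose_mul_block_mul_inr 0 (α • β) (scalarTuple γ) i, block_eq]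
    simp
  have hγ : scalarTuple γ = 0 := funext fun i => by
    rw [← inr_transpose_mul_block_mul_inr 0 (α • β) (scalarTuple γ) i, block_eq]
    simp
  exact Prod.ext ((smul_eq_zero.1 hα).resolve_right hβ)
    (funext fun i => congrFun (congrFun (congrFun hγ i) 0) 0)

lemma isCompact_setOf_block_smul_mem (hb : IsBoundedSet (spectrahedron A)) (X : MatTuple g n n)
    {β : MatTuple g n 1} (hβ : β ≠ 0) :
    IsCompact {p : ℝ × (Fin g → ℝ) |
      block X (p.1 • β) (scalarTuple p.2) ∈ spectrahedron A (n + 1)} := by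
  have block_eq (p : ℝ × (Fin g → ℝ)) :
      block X (p.1 • β) (scalarTuple p.2) = block X 0 0 + dilationDirection β p := by
    simp only [dilationDirection, LinearMap.coe_mk, AddHom.coe_mk, ← block_add, add_zero, zero_add]
  simp only [block_eq]
  exact isCompact_preimage_add_linearMap (dilationDirection_injective hβ) _
    (isCompact_spectrahedron hb _)

lemma isCompact_gammaSet (hb : IsBoundedSet (spectrahedron A)) (X : MatTuple g n n)
    {β : MatTuple g n 1} (hβ : β ≠ 0) : IsCompact (gammaSet (spectrahedron A) X β) := by
  have slice := (isCompact_setOf_block_smul_mem hb X hβ).inter_right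
    (isClosed_singleton.preimage continuous_fst : IsClosed (Prod.fst ⁻¹' {(1 : ℝ)}))
  convert slice.image continuous_snd
  ext γ
  simp [gammaSet]

theorem exists_isMaximalOneDilation (hb : IsBoundedSet (spectrahedron A))
    (hX : X ∈ spectrahedron A n) (hXe : ¬ IsArvesonExtreme (spectrahedron A) X) :
    ∃ Y, IsMaximalOneDilation A X Y := by
  obtain ⟨β, hβ, γ₁, h₁⟩ := exists_block_scalarTuple_mem hX hXe
  obtain ⟨⟨α, γ₂⟩, h₂, α_max⟩ := (isCompact_setOf_block_smul_mem hb X hβ).exists_isMaxOn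
    ⟨(1, γ₁), by simpa using h₁⟩ continuous_fst.continuousOn
  have hα : 0 < α := zero_lt_one.trans_le (α_max (a := (1, γ₁)) (by simpa using h₁))
  have hαβ : α • β ≠ 0 := smul_ne_zero hα.ne' hβ
  obtain ⟨γ, hγ⟩ := (isCompact_gammaSet hb X hαβ).extremePoints_nonempty ⟨γ₂, h₂⟩
  refine ⟨block X (α • β) (scalarTuple γ), hγ.1, α • β, γ, rfl, hαβ, ⟨⟨γ, ?_⟩, ?_⟩, hγ⟩
  · rw [one_smul]
    exact hγ.1.2
  · rintro α' ⟨γ', hpos⟩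
    rw [smul_smul] at hpos
    have : α' * α ≤ α :=
      α_max (a := (α' * α, γ')) ⟨block_isSymm hX.1 _ (scalarTuple_isSymm γ'), hpos⟩
    exact (mul_le_iff_le_one_left hα).1 this

end Existence

end FreeSpec

end

theorem theorem4p6 {H : Type*} [NormedAddCommGroup H] [InnerProductSpace ℝ H] [CompleteSpace H]
    {g n : ℕ} (A : Fin g → H →L[ℝ] H)
    (hA : ∀ i, IsSelfAdjoint (A i)) (hAc : ∀ i, IsCompactOperator (A i))
    (hb : FreeSpec.IsBoundedSet (FreeSpec.spectrahedron A))
    (X : FreeSpec.MatTuple g n n) (hX : X ∈ FreeSpec.spectrahedron A n)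
    (hXe : ¬ FreeSpec.IsArvesonExtreme (FreeSpec.spectrahedron A) X) :
    (∃ Y : FreeSpec.MatTuple g (n + 1) (n + 1), FreeSpec.IsMaximalOneDilation A X Y) ∧
    ∀ Y : FreeSpec.MatTuple g (n + 1) (n + 1), FreeSpec.IsMaximalOneDilation A X Y →
      Module.finrank ℝ (FreeSpec.dilationSubspace (FreeSpec.spectrahedron A) Y) <
        Module.finrank ℝ (FreeSpec.dilationSubspace (FreeSpec.spectrahedron A) X) :=
  ⟨FreeSpec.exists_isMaximalOneDilation hb hX hXe,
    fun _ hY => FreeSpec.finrank_dilationSubspace_lt hA hAc hX hY⟩
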